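/- For $n\ge 0$ let $IP_n:\{0,1\}^n\times\{0,1\}^n\to\{0,1\}$, $IP_n(x,y)=\sum_{i=1}^n x_iy_i \bmod 2$. For a function $f:X\times Y\to\{0,1\}$ on finite sets, a one-way quantum protocol with $q$ qubits (without shared randomness or shared entanglement) consists of a $q$-qubit state $\rho_x$ (a positive semidefinite $2^q\times 2^q$ complex matrix of trace $1$) for every $x\in X$, sent by Alice, and a two-outcome POVM $\{E^y_0,E^y_1\}$ (positive semidefinite matrices with $E^y_0+E^y_1=I$) for every $y\in Y$, with which Bob measures the state he receives; he outputs $b$ with probability $\mathrm{Tr}(E^y_b\rho_x)$. Let $Q(f)$, the unbounded-error one-way quantum communication complexity of $f$, be the least $q\ge 0$ for which there is such a protocol that on every input $(x,y)$ outputs $f(x,y)$ with probability strictly larger than $1/2$. Then for every $n$, $$\left\lceil \frac n4\right\rceil\ \le\ Q(IP_n)\ \le\ \left\lceil\frac{(\log_2 3)\,n+2}{4}\right\rceil .$$ -/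

import Mathlib

open scoped ComplexOrder

/-- An `N`-level quantum state: a positive semidefinite complex `N × N` matrix of trace `1`. -/
structure QuantumState (N : ℕ) where
  mat : Matrix (Fin N) (Fin N) ℂ
  posSemidef : mat.PosSemidef
  trace_eq_one : mat.trace = 1

/-- A two-outcome POVM over `N`-level quantum states, with outcomes in `{0, 1} = ZMod 2`. -/
structure BinaryPOVM (N : ℕ) where
  effect : ZMod 2 → Matrix (Fin N) (Fin N) ℂ
  posSemidef : ∀ b, (effect b).PosSemidef
  sum_eq_one : ∑ b, effect b = 1

/-- The probability `Tr (E_b ρ)` that measuring `ρ` with the POVM `E` yields the outcome `b`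
(the trace is a real number). -/
noncomputable def BinaryPOVM.prob {N : ℕ} (E : BinaryPOVM N) (ρ : QuantumState N)
    (b : ZMod 2) : ℝ :=
  (E.effect b * ρ.mat).trace.re

/-- A one-way quantum protocol with `q` qubits of communication, without shared randomness or
shared entanglement: on input `x` Alice sends a (possibly mixed) `q`-qubit state to Bob, and Bob
on input `y` outputs the outcome of a two-outcome measurement of that state. -/
structure OneWayQuantumProtocol (X Y : Type*) (q : ℕ) where
  state : X → QuantumState (2 ^ q)
  measurement : Y → BinaryPOVM (2 ^ q)

/-- The protocol computes `f` with unbounded error: on every input, the correct value is output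
with probability strictly larger than `1/2`. -/
def OneWayQuantumProtocol.Computes {X Y : Type*} {q : ℕ} (P : OneWayQuantumProtocol X Y q)
    (f : X → Y → ZMod 2) : Prop :=
  ∀ x y, 1 / 2 < (P.measurement y).prob (P.state x) (f x y)

/-- The unbounded-error one-way quantum communication complexity `Q(f)`: the least number of
qubits of a one-way quantum protocol computing `f` with unbounded error (`⊤` if there were none).
-/
noncomputable def unboundedErrorQ {X Y : Type*} (f : X → Y → ZMod 2) : ℕ∞ :=
  ⨅ (q : ℕ) (_ : ∃ P : OneWayQuantumProtocol X Y q, P.Computes f), (q : ℕ∞)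

/-- The inner product mod 2 function on pairs of `n`-bit strings. -/
def innerProductMod2 (n : ℕ) (x y : Fin n → ZMod 2) : ZMod 2 :=
  ∑ i, x i * y i

/-! ### Determinants of weighted Gram matrices; vectors in isotropic position. -/

section Forster

open Matrix Finset

/-! Hermitian `2^q × 2^q` matrices form a real inner product space of dimension `4^q`, so a protocol
for `f` realizes the sign matrix of `f` by inner products of vectors in that space.

Lower bound: the sign matrix of `IP_n` has orthogonal rows. Forster's theorem
(`card_le_sq_of_sign_realization`) says that a `d`-dimensional realization of such a matrix of order
`N` has `N ≤ d ^ 2`; hence `2^n ≤ 16^q`. Its proof rescales the vectors to near-isotropic position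
with nearly equal lengths (`exists_weights_leverage_le`) and compares two bounds on a bilinear form
(`one_le_mul_card_of_isotropic`).

Upper bound: `IP_2` has a realization in dimension 3, and tensoring realizes `IP_n` in dimension
about `3^(n/2)`. Conversely, a realization that fits into the off-diagonal entries becomes a
protocol of tiny bias around the maximally mixed state (`exists_computes_of_sign_realization`). -/

/-- The sum of the rank-one matrices `wᵢ xᵢ xᵢᵀ` over a finite set of indices. -/
def weightedGram {Γ ι : Type*} (x : Γ → ι → ℝ) (w : Γ → ℝ) (s : Finset Γ) : Matrix ι ι ℝ :=
  ∑ i ∈ s, w i • vecMulVec (x i) (x i)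

variable {Γ ι : Type*} [Fintype ι] [DecidableEq ι]

omit [DecidableEq ι] in
lemma posSemidef_weightedGram (x : Γ → ι → ℝ) {w : Γ → ℝ} (hw : ∀ i, 0 ≤ w i) (s : Finset Γ) :
    (weightedGram x w s).PosSemidef := by
  refine posSemidef_sum s fun i _ ↦ ?_
  exact (by simpa using posSemidef_vecMulVec_self_star (x i) :
    (vecMulVec (x i) (x i)).PosSemidef).smul (hw i)

lemma det_add_smul_vecMulVec {P : Matrix ι ι ℝ} (hP : IsUnit P.det) (c : ℝ) (x : ι → ℝ) :
    (P + c • vecMulVec x x).det = P.det * (1 + c * (x ⬝ᵥ P⁻¹ *ᵥ x)) := by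
  have h := det_add_replicateCol_mul_replicateRow (ι := Unit) hP (c • x) x
  rw [← vecMulVec_eq, smul_vecMulVec] at h
  rw [h]
  congr 1
  rw [det_unique (n := Unit), Matrix.mul_assoc, ← replicateCol_mulVec, mulVec_smul]
  simp [Matrix.mul_apply, dotProduct, mul_sum]

lemma det_le_det_add_weightedGram {P : Matrix ι ι ℝ} (hP : P.PosDef) (x : Γ → ι → ℝ)
    {w : Γ → ℝ} (hw : ∀ i, 0 ≤ w i) (s : Finset Γ) :
    P.det ≤ (P + weightedGram x w s).det := by
  classical
  induction s using Finset.induction_on with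
  | empty => simp [weightedGram]
  | insert a s ha ih =>
    have hQ : (P + weightedGram x w s).PosDef := hP.add_posSemidef (posSemidef_weightedGram x hw s)
    have hsum : P + weightedGram x w (insert a s) =
        (P + weightedGram x w s) + w a • vecMulVec (x a) (x a) := by
      rw [weightedGram, sum_insert ha, weightedGram]; abel
    rw [hsum, det_add_smul_vecMulVec hQ.det_pos.ne'.isUnit]
    have h0 : 0 ≤ x a ⬝ᵥ (P + weightedGram x w s)⁻¹ *ᵥ x a := by
      simpa using hQ.inv.posSemidef.dotProduct_mulVec_nonneg (x a)
    have := mul_nonneg (hw a) h0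
    nlinarith [hQ.det_pos]

omit [Fintype ι] [DecidableEq ι] in
lemma weightedGram_map {κ : Type*} [Fintype κ] [DecidableEq κ] (x : Γ → ι → ℝ) (w : Γ → ℝ) (f : κ ↪ Γ) :
    weightedGram x w (univ.map f) =
      (Matrix.of fun a ↦ x (f a) : Matrix κ ι ℝ)ᵀ * diagonal (fun a ↦ w (f a)) *
        (Matrix.of fun a ↦ x (f a) : Matrix κ ι ℝ) := by
  ext k l
  rw [Matrix.mul_apply]
  simp only [weightedGram, sum_map, Matrix.sum_apply, Matrix.smul_apply, vecMulVec_apply,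
    smul_eq_mul, mul_diagonal, transpose_apply, of_apply]
  exact sum_congr rfl fun i _ ↦ by ring

/-- The indices in the range of `f` alone contribute one Cauchy–Binet term; the others add a
positive semidefinite matrix, which cannot lower the determinant. -/
lemma posDef_and_det_le_weightedGram [Fintype Γ] (x : Γ → ι → ℝ) {w : Γ → ℝ} (hw : ∀ i, 0 < w i)
    (f : ι ↪ Γ) (hf : (Matrix.of fun a ↦ x (f a) : Matrix ι ι ℝ).det ≠ 0) :
    (weightedGram x w univ).PosDef ∧
      (Matrix.of fun a ↦ x (f a) : Matrix ι ι ℝ).det ^ 2 * ∏ a, w (f a) ≤ (weightedGram x w univ).det := by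
  classical
  have hw' : ∀ i, 0 ≤ w i := fun i ↦ (hw i).le
  have hdet : (weightedGram x w (univ.map f)).det =
      (Matrix.of fun a ↦ x (f a) : Matrix ι ι ℝ).det ^ 2 * ∏ a, w (f a) := by
    rw [weightedGram_map, det_mul, det_mul, det_transpose, det_diagonal]; ring
  have hP : (weightedGram x w (univ.map f)).PosDef := by
    rw [(posSemidef_weightedGram x hw' _).posDef_iff_det_ne_zero, hdet]
    exact mul_ne_zero (pow_ne_zero 2 hf) (prod_pos fun a _ ↦ hw _).ne'
  have hsplit : weightedGram x w univ =
      weightedGram x w (univ.map f) + weightedGram x w (univ.map f)ᶜ :=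
    (sum_add_sum_compl _ _).symm
  rw [hsplit, ← hdet]
  exact ⟨hP.add_posSemidef (posSemidef_weightedGram x hw' _),
    det_le_det_add_weightedGram hP x hw' _⟩

omit [DecidableEq ι] in
/-- The bilinear form of a matrix with orthogonal rows of squared norm `card Γ` is bounded. -/
lemma sq_sum_mul_dotProduct_le [DecidableEq Γ] [Fintype Γ] (M : Γ → Γ → ℝ)
    (hM : ∀ i i', ∑ j, M i j * M i' j = if i = i' then (Fintype.card Γ : ℝ) else 0)
    (y z : Γ → ι → ℝ) :
    (∑ j, ∑ i, M i j * (y i ⬝ᵥ z j)) ^ 2 ≤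
      (Fintype.card Γ * ∑ k, ∑ i, y i k ^ 2) * ∑ j, z j ⬝ᵥ z j := by
  have h1 : ∑ j, ∑ i, M i j * (y i ⬝ᵥ z j) =
      ∑ p : Γ × ι, (∑ i, M i p.1 * y i p.2) * z p.1 p.2 := by
    rw [Fintype.sum_prod_type]
    refine sum_congr rfl fun j _ ↦ ?_
    simp only [dotProduct, mul_sum, sum_mul]
    rw [sum_comm]
    exact sum_congr rfl fun k _ ↦ sum_congr rfl fun i _ ↦ by ring
  have h2 : ∑ p : Γ × ι, (∑ i, M i p.1 * y i p.2) ^ 2 =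
      Fintype.card Γ * ∑ k, ∑ i, y i k ^ 2 := by
    rw [Fintype.sum_prod_type_right, mul_sum]
    refine sum_congr rfl fun k _ ↦ ?_
    calc ∑ j, (∑ i, M i j * y i k) ^ 2
        = ∑ j, ∑ i, ∑ i', y i k * y i' k * (M i j * M i' j) := by
          refine sum_congr rfl fun j _ ↦ ?_
          rw [sq, sum_mul_sum]
          exact sum_congr rfl fun i _ ↦ sum_congr rfl fun i' _ ↦ by ring
      _ = ∑ i, ∑ i', y i k * y i' k * ∑ j, M i j * M i' j := by
          rw [sum_comm]
          refine sum_congr rfl fun i _ ↦ ?_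
          rw [sum_comm]
          exact sum_congr rfl fun i' _ ↦ by rw [mul_sum]
      _ = _ := by
          simp only [hM, mul_ite, mul_zero, sum_ite_eq, mem_univ, if_true, mul_sum]
          exact sum_congr rfl fun i _ ↦ by ring
  have h3 : ∑ p : Γ × ι, z p.1 p.2 ^ 2 = ∑ j, z j ⬝ᵥ z j := by
    rw [Fintype.sum_prod_type]
    simp only [dotProduct, sq]
  rw [h1, ← h2, ← h3]
  exact sum_mul_sq_le_sq_mul_sq _ _ _

/-- The quantitative step in Forster's theorem: vectors in isotropic position that realize the
signs of an orthogonal sign matrix cannot all be short. -/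
lemma one_le_mul_card_of_isotropic [Fintype Γ] [Nonempty Γ] [DecidableEq Γ] (M : Γ → Γ → ℝ)
    (hM1 : ∀ i j, |M i j| = 1)
    (hM : ∀ i i', ∑ j, M i j * M i' j = if i = i' then (Fintype.card Γ : ℝ) else 0)
    (y z : Γ → ι → ℝ) (hy : ∀ u : ι → ℝ, ∑ i, (y i ⬝ᵥ u) ^ 2 = u ⬝ᵥ u)
    {κ : ℝ} (hκ : ∀ i, y i ⬝ᵥ y i ≤ κ) (hpos : ∀ i j, 0 < M i j * (y i ⬝ᵥ z j)) :
    1 ≤ κ * Fintype.card ι := by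
  wlog hz : ∀ j, z j ⬝ᵥ z j = 1 generalizing z
  -- Normalizing each `z j` changes no sign.
  · have hzpos : ∀ j, 0 < z j ⬝ᵥ z j := fun j ↦ by
      refine lt_of_le_of_ne (by simpa using dotProduct_star_self_nonneg (z j)) fun h ↦ ?_
      have h0 : z j = 0 := dotProduct_self_eq_zero.1 h.symm
      have := hpos (Classical.arbitrary Γ) j
      simp [h0] at this
    refine this (fun j ↦ (√(z j ⬝ᵥ z j))⁻¹ • z j) (fun i j ↦ ?_) fun j ↦ ?_
    · have := mul_pos (inv_pos.2 (Real.sqrt_pos.2 (hzpos j))) (hpos i j)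
      rw [dotProduct_smul, smul_eq_mul]
      linarith
    · rw [dotProduct_smul, smul_dotProduct, smul_eq_mul, smul_eq_mul, ← mul_assoc, ← mul_inv,
        Real.mul_self_sqrt (hzpos j).le, inv_mul_cancel₀ (hzpos j).ne']
  have hκ0 : 0 ≤ κ :=
    le_trans (by simpa using dotProduct_star_self_nonneg (y (Classical.arbitrary Γ))) (hκ _)
  have habs : ∀ i j, |y i ⬝ᵥ z j| = M i j * (y i ⬝ᵥ z j) := fun i j ↦ by
    rw [← abs_of_pos (hpos i j), abs_mul, hM1, one_mul]
  have hle : ∀ i j, |y i ⬝ᵥ z j| ≤ √κ := fun i j ↦ by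
    refine Real.abs_le_sqrt ?_
    have h := sum_mul_sq_le_sq_mul_sq univ (y i) (z j)
    have h1 : ∑ k, y i k ^ 2 = y i ⬝ᵥ y i := by simp [dotProduct, sq]
    have h2 : ∑ k, z j k ^ 2 = 1 := by rw [← hz j]; simp [dotProduct, sq]
    rw [h1, h2, mul_one] at h
    exact h.trans (hκ i)
  set T := ∑ j, ∑ i, M i j * (y i ⬝ᵥ z j) with hT
  -- By isotropy each unit vector `z j` has `∑ i, (y i ⬝ᵥ z j) ^ 2 = 1`, and one factor of each
  -- square is at most `√κ`.
  have hN : (Fintype.card Γ : ℝ) ≤ √κ * T := by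
    have : ∀ j, (1 : ℝ) ≤ √κ * ∑ i, M i j * (y i ⬝ᵥ z j) := fun j ↦ by
      rw [← hz j, ← hy (z j), mul_sum]
      refine sum_le_sum fun i _ ↦ ?_
      rw [← habs, ← sq_abs, sq]
      exact mul_le_mul_of_nonneg_right (hle i j) (abs_nonneg _)
    calc (Fintype.card Γ : ℝ) = ∑ _j : Γ, (1 : ℝ) := by simp
      _ ≤ ∑ j, √κ * ∑ i, M i j * (y i ⬝ᵥ z j) := sum_le_sum fun j _ ↦ this j
      _ = √κ * T := by rw [← mul_sum]
  have hcol : ∀ k, ∑ i, y i k ^ 2 = 1 := fun k ↦ by simpa using hy (Pi.single k 1)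
  have hT2 := sq_sum_mul_dotProduct_le M hM y z
  simp only [hcol, hz, sum_const, card_univ, nsmul_eq_mul, mul_one, ← hT] at hT2
  have hc : (0 : ℝ) < Fintype.card Γ := by exact_mod_cast Fintype.card_pos
  have h1 : (Fintype.card Γ : ℝ) ^ 2 ≤ κ * T ^ 2 := by
    calc (Fintype.card Γ : ℝ) ^ 2 ≤ (√κ * T) ^ 2 := pow_le_pow_left₀ hc.le hN 2
      _ = κ * T ^ 2 := by rw [mul_pow, Real.sq_sqrt hκ0]
  have h2 := mul_le_mul_of_nonneg_left hT2 hκ0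
  have h3 : 0 < (Fintype.card Γ : ℝ) ^ 2 := by positivity
  by_contra! h4
  nlinarith

end Forster

/-! ### Forster's rescaling and theorem. -/

section Forster

open Matrix Finset

variable {Γ ι : Type*} [AddGroup Γ] [Fintype Γ] [Fintype ι]

/-- Average over `g`: each index is hit equally often. Thanks to the group structure, general
position is needed only for the translates of one index set. -/
lemma exists_translate_sum_ge (e : ι ↪ Γ) (t : Γ → ℝ) :
    ∃ g, (Fintype.card ι / Fintype.card Γ : ℝ) * ∑ i, t i ≤ ∑ a, t (g + e a) := by
  have hc : (Fintype.card Γ : ℝ) ≠ 0 := by exact_mod_cast Fintype.card_ne_zero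
  have h : ∑ _g : Γ, (Fintype.card ι / Fintype.card Γ : ℝ) * ∑ i, t i ≤
      ∑ g, ∑ a, t (g + e a) := by
    rw [sum_comm]
    have : ∀ a, ∑ g, t (g + e a) = ∑ i, t i := fun a ↦
      Equiv.sum_comp (Equiv.addRight (e a)) t
    simp only [this, sum_const, card_univ, nsmul_eq_mul]
    field_simp
    exact le_rfl
  obtain ⟨g, -, hg⟩ := exists_le_of_sum_le univ_nonempty h
  exact ⟨g, hg⟩

/-- Forster's rescaling: weights for which all vectors have almost the same leverage. -/
lemma exists_weights_leverage_le [DecidableEq ι] (e : ι ↪ Γ) (x : Γ → ι → ℝ)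
    (hx : ∀ g, (Matrix.of fun a ↦ x (g + e a) : Matrix ι ι ℝ).det ≠ 0) {σ : ℝ} (hσ : 0 < σ) :
    ∃ w : Γ → ℝ, (∀ i, 0 < w i) ∧ (weightedGram x w univ).PosDef ∧
      ∀ i, w i * (x i ⬝ᵥ (weightedGram x w univ)⁻¹ *ᵥ x i) ≤
        (Fintype.card ι / Fintype.card Γ + σ) * (1 + σ) := by
  classical
  set r : ℝ := Fintype.card ι / Fintype.card Γ with hr
  have hr0 : 0 ≤ r := by positivity
  let G : (Γ → ℝ) → Matrix ι ι ℝ := fun t ↦ weightedGram x (fun i ↦ Real.exp (t i)) univ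
  have key : ∀ t g, (G t).PosDef ∧
      (Matrix.of fun a ↦ x (g + e a) : Matrix ι ι ℝ).det ^ 2 *
        ∏ a, Real.exp (t (g + e a)) ≤ (G t).det := fun t g ↦
    posDef_and_det_le_weightedGram x (fun i ↦ Real.exp_pos (t i))
      (e.trans (Equiv.addLeft g).toEmbedding) (hx g)
  let h : (Γ → ℝ) → ℝ := fun t ↦ Real.log (G t).det - r * ∑ i, t i
  let c : Γ → ℝ := fun g ↦ Real.log ((Matrix.of fun a ↦ x (g + e a) : Matrix ι ι ℝ).det ^ 2)
  -- The Cauchy–Binet term of a heavy translate makes `log det` outgrow `r * ∑ i, t i`.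
  have hbdd : BddBelow (Set.range h) := by
    refine ⟨univ.inf' univ_nonempty c, ?_⟩
    rintro _ ⟨t, rfl⟩
    obtain ⟨g, hg⟩ := exists_translate_sum_ge e t
    refine (inf'_le c (mem_univ g)).trans ?_
    have hpos : 0 < (Matrix.of fun a ↦ x (g + e a) : Matrix ι ι ℝ).det ^ 2 :=
      by have := hx g; positivity
    have h1 := Real.log_le_log (mul_pos hpos (prod_pos fun a _ ↦ Real.exp_pos _)) (key t g).2
    rw [Real.log_mul hpos.ne' (prod_pos fun a _ ↦ Real.exp_pos _).ne', ← Real.exp_sum,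
      Real.log_exp] at h1
    change c g ≤ Real.log (G t).det - r * ∑ i, t i
    linarith
  -- The infimum need not be attained; a minimizer up to `σ ^ 2` suffices when tested against a
  -- change of size `σ` in one coordinate.
  obtain ⟨t, ht⟩ := exists_lt_of_ciInf_lt (show iInf h < iInf h + σ ^ 2 by
    linarith [pow_pos hσ 2])
  have hmin : ∀ t', h t < h t' + σ ^ 2 := fun t' ↦ ht.trans_le (by
    linarith [ciInf_le hbdd t'])
  refine ⟨fun i ↦ Real.exp (t i), fun i ↦ Real.exp_pos _, (key t 0).1, fun i ↦ ?_⟩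
  change Real.exp (t i) * (x i ⬝ᵥ (G t)⁻¹ *ᵥ x i) ≤ _
  set a := Real.exp (t i) * (x i ⬝ᵥ (G t)⁻¹ *ᵥ x i) with ha
  let t' : Γ → ℝ := Function.update t i (t i - σ)
  have hG : G t' = G t + (Real.exp (t i) * (Real.exp (-σ) - 1)) • vecMulVec (x i) (x i) := by
    simp only [G, weightedGram]
    rw [← add_sum_erase _ _ (mem_univ i), ← add_sum_erase _ _ (mem_univ i)]
    have : ∑ j ∈ univ.erase i, Real.exp (t' j) • vecMulVec (x j) (x j) =
        ∑ j ∈ univ.erase i, Real.exp (t j) • vecMulVec (x j) (x j) :=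
      sum_congr rfl fun j hj ↦ by simp [t', Function.update_of_ne (ne_of_mem_erase hj)]
    rw [this, add_right_comm, ← add_smul]
    congr 2
    simp only [t', Function.update_self, sub_eq_add_neg, Real.exp_add]
    ring
  have hdet : (G t').det = (G t).det * (1 + (Real.exp (-σ) - 1) * a) := by
    rw [hG, det_add_smul_vecMulVec (key t 0).1.det_pos.ne'.isUnit, ha]
    ring
  have hsum : ∑ j, t' j = ∑ j, t j - σ := by
    rw [sum_update_of_mem (mem_univ i), ← add_sum_erase univ t (mem_univ i), sdiff_singleton_eq_erase]
    ring
  have hfac : 0 < 1 + (Real.exp (-σ) - 1) * a := by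
    have := (key t' 0).1.det_pos
    rw [hdet] at this
    exact (pos_iff_pos_of_mul_pos this).1 (key t 0).1.det_pos
  have hineq := hmin t'
  simp only [h, hdet, hsum] at hineq
  rw [Real.log_mul (key t 0).1.det_pos.ne' hfac.ne'] at hineq
  have hlog := Real.log_le_sub_one_of_pos hfac
  have h1 : (1 - Real.exp (-σ)) * a ≤ r * σ + σ ^ 2 := by nlinarith
  have ha0 : 0 ≤ a := mul_nonneg (Real.exp_pos _).le
    (by simpa using (key t 0).1.inv.posSemidef.dotProduct_mulVec_nonneg (x i))
  have h2 : σ / (1 + σ) ≤ 1 - Real.exp (-σ) := by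
    have h3 : Real.exp (-σ) ≤ 1 / (1 + σ) := by
      rw [Real.exp_neg, inv_eq_one_div]
      exact one_div_le_one_div_of_le (by linarith) (by linarith [Real.add_one_le_exp σ])
    have h4 : σ / (1 + σ) = 1 - 1 / (1 + σ) := by field_simp; ring
    linarith
  have h3 : σ / (1 + σ) * a ≤ r * σ + σ ^ 2 := (mul_le_mul_of_nonneg_right h2 ha0).trans h1
  rw [div_mul_eq_mul_div, div_le_iff₀ (by linarith)] at h3
  nlinarith

/-- Vectors in general position realizing the signs of an orthogonal sign matrix. -/
lemma card_le_sq_of_det_ne_zero [DecidableEq Γ] [DecidableEq ι] (M : Γ → Γ → ℝ)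
    (hM1 : ∀ i j, |M i j| = 1)
    (hM : ∀ i i', ∑ j, M i j * M i' j = if i = i' then (Fintype.card Γ : ℝ) else 0)
    (e : ι ↪ Γ) (x v : Γ → ι → ℝ)
    (hx : ∀ g, (Matrix.of fun a ↦ x (g + e a) : Matrix ι ι ℝ).det ≠ 0)
    (hpos : ∀ i j, 0 < M i j * (x i ⬝ᵥ v j)) :
    Fintype.card Γ ≤ Fintype.card ι ^ 2 := by
  have hσ : ∀ σ : ℝ, 0 < σ →
      1 ≤ (Fintype.card ι / Fintype.card Γ + σ) * (1 + σ) * Fintype.card ι := fun σ hσ ↦ by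
    obtain ⟨w, hw, hG, hlev⟩ := exists_weights_leverage_le e x hx hσ
    -- With `G = Bᵀ * B`, replacing `x i` by `√(w i) • (x i ᵥ* B⁻¹)` gives isotropic position, and
    -- `B *ᵥ v j` compensates so that signs are kept.
    obtain ⟨B, hB, hGB⟩ : ∃ B : Matrix ι ι ℝ, IsUnit B ∧ weightedGram x w univ = Bᵀ * B := by
      open scoped MatrixOrder in
      refine ⟨CFC.sqrt (weightedGram x w univ), ?_, ?_⟩
      · exact (CFC.isUnit_sqrt_iff _ hG.posSemidef.nonneg).2 hG.isUnit
      · have h1 := (CFC.sqrt_nonneg (weightedGram x w univ)).posSemidef.isHermitian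
        rw [IsHermitian, conjTranspose_eq_transpose_of_trivial] at h1
        rw [h1, CFC.sqrt_mul_sqrt_self _ hG.posSemidef.nonneg]
    have hBd : IsUnit B.det := (isUnit_iff_isUnit_det B).1 hB
    set G := weightedGram x w univ with hGdef
    have hquad : ∀ u : ι → ℝ, ∑ i, w i * (x i ⬝ᵥ u) ^ 2 = u ⬝ᵥ G *ᵥ u := fun u ↦ by
      rw [hGdef, weightedGram, sum_mulVec, dotProduct_sum]
      refine sum_congr rfl fun i _ ↦ ?_
      rw [smul_mulVec, vecMulVec_mulVec]
      rw [dotProduct_comm u]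
      simp only [op_smul_eq_smul, smul_dotProduct, smul_eq_mul]
      ring
    refine one_le_mul_card_of_isotropic M hM1 hM (fun i ↦ √(w i) • (x i ᵥ* B⁻¹))
      (fun j ↦ B *ᵥ v j) (fun u ↦ ?_) (fun i ↦ ?_) fun i j ↦ ?_
    · have h1 : ∀ i, (√(w i) • (x i ᵥ* B⁻¹) ⬝ᵥ u) ^ 2 = w i * (x i ⬝ᵥ B⁻¹ *ᵥ u) ^ 2 := fun i ↦ by
        rw [smul_dotProduct, smul_eq_mul, mul_pow, Real.sq_sqrt (hw i).le, dotProduct_mulVec]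
      simp only [h1]
      rw [hquad, hGB, ← mulVec_mulVec, dotProduct_mulVec, vecMul_transpose, mulVec_mulVec,
        mul_nonsing_inv _ hBd, one_mulVec]
    · refine le_of_eq_of_le ?_ (hlev i)
      rw [smul_dotProduct, dotProduct_smul, smul_eq_mul, smul_eq_mul, ← mul_assoc,
        Real.mul_self_sqrt (hw i).le, hGB, Matrix.mul_inv_rev, ← mulVec_mulVec, dotProduct_mulVec,
        ← transpose_nonsing_inv, mulVec_transpose]
    · rw [smul_dotProduct, ← dotProduct_mulVec, mulVec_mulVec, nonsing_inv_mul _ hBd, one_mulVec,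
        smul_eq_mul]
      have := mul_pos (Real.sqrt_pos.2 (hw i)) (hpos i j)
      linarith
  have hlim : (1 : ℝ) ≤ (Fintype.card ι / Fintype.card Γ + 0) * (1 + 0) * Fintype.card ι := by
    have hc : Continuous fun σ : ℝ ↦
        ((Fintype.card ι / Fintype.card Γ + σ) * (1 + σ) * Fintype.card ι : ℝ) := by fun_prop
    refine ge_of_tendsto ((hc.tendsto 0).mono_left (nhdsWithin_le_nhds (s := Set.Ioi 0))) ?_
    filter_upwards [self_mem_nhdsWithin] with σ h using hσ σ h
  have hc : (0 : ℝ) < Fintype.card Γ := by exact_mod_cast Fintype.card_pos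
  rw [add_zero, add_zero, mul_one, div_mul_eq_mul_div, le_div_iff₀ hc, one_mul, ← sq] at hlim
  exact_mod_cast hlim

/-- **Forster's theorem** for orthogonal sign matrices. -/
theorem card_le_sq_of_sign_realization [DecidableEq Γ] (M : Γ → Γ → ℝ)
    (hM1 : ∀ i j, |M i j| = 1)
    (hM : ∀ i i', ∑ j, M i j * M i' j = if i = i' then (Fintype.card Γ : ℝ) else 0)
    {d : ℕ} (x v : Γ → Fin d → ℝ) (hpos : ∀ i j, 0 < M i j * (x i ⬝ᵥ v j)) :
    Fintype.card Γ ≤ d ^ 2 := by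
  obtain hd | hd := le_total (Fintype.card Γ) d
  · exact hd.trans (Nat.le_self_pow two_ne_zero d)
  obtain ⟨e⟩ : Nonempty (Fin d ↪ Γ) := Function.Embedding.nonempty_of_card_le (by simpa using hd)
  let φ : Γ → ℝ := fun g ↦ ((Fintype.equivFin Γ g : ℕ) : ℝ)
  have hφ : Function.Injective φ := fun a b h ↦ by
    simpa [φ, Fin.val_inj] using h
  -- Perturbing along the moment curve gives general position: each determinant is a polynomial in
  -- `s` with a nonzero Vandermonde leading coefficient, and small `s` preserves all signs.
  let W : Γ → Fin d → ℝ := fun g k ↦ φ g ^ (k : ℕ)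
  have hdet : ∀ g, ∀ᶠ s in nhdsWithin (0 : ℝ) (Set.Ioi 0),
      (Matrix.of fun a ↦ (x (g + e a) + s • W (g + e a)) : Matrix (Fin d) (Fin d) ℝ).det ≠ 0 := by
    intro g
    let A : Matrix (Fin d) (Fin d) ℝ := vandermonde fun a ↦ φ (g + e a)
    let B : Matrix (Fin d) (Fin d) ℝ := Matrix.of fun a ↦ x (g + e a)
    let p : Polynomial ℝ := det ((Polynomial.X : Polynomial ℝ) • A.map Polynomial.C +
      B.map Polynomial.C)
    have hp : p ≠ 0 := fun h ↦ by
      have h1 := Polynomial.coeff_det_X_add_C_card A B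
      rw [show det ((Polynomial.X : Polynomial ℝ) • A.map Polynomial.C +
        B.map Polynomial.C) = 0 from h, Polynomial.coeff_zero] at h1
      refine det_vandermonde_ne_zero_iff.2 ?_ h1.symm
      exact hφ.comp ((add_right_injective g).comp e.injective)
    have hfin : {s : ℝ | p.IsRoot s}.Finite := Polynomial.finite_setOfPred_isRoot hp
    have hev : ∀ s, p.eval s =
        (Matrix.of fun a ↦ (x (g + e a) + s • W (g + e a)) : Matrix (Fin d) (Fin d) ℝ).det := by
      intro s
      rw [← Polynomial.coe_evalRingHom, RingHom.map_det]
      congr 1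
      ext a k
      simp [A, B, W, vandermonde_apply]
      ring
    have hmem : ({s : ℝ | p.IsRoot s} \ {0})ᶜ ∈ nhds (0 : ℝ) :=
      (hfin.subset Set.sdiff_subset).isClosed.isOpen_compl.mem_nhds (by simp)
    filter_upwards [self_mem_nhdsWithin, nhdsWithin_le_nhds hmem] with s hs hs'
    rw [← hev]
    intro h
    exact hs' ⟨h, ne_of_gt hs⟩
  have hsign : ∀ i j, ∀ᶠ s in nhdsWithin (0 : ℝ) (Set.Ioi 0),
      0 < M i j * ((x i + s • W i) ⬝ᵥ v j) := by
    intro i j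
    have hc : Continuous fun s : ℝ ↦ M i j * ((x i + s • W i) ⬝ᵥ v j) := by
      simp only [add_dotProduct, smul_dotProduct, smul_eq_mul]
      fun_prop
    exact nhdsWithin_le_nhds (hc.continuousAt.eventually_const_lt (by simpa using hpos i j))
  obtain ⟨s, hs1, hs2⟩ := ((Filter.eventually_all.2 hdet).and (Filter.eventually_all.2 fun i ↦
    Filter.eventually_all.2 (hsign i))).exists
  simpa using card_le_sq_of_det_ne_zero M hM1 hM e (fun i ↦ x i + s • W i) v hs1 hs2

end Forster

/-! ### Orthogonality of the inner product sign matrix. -/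

section Sign

open Finset

/-- The sign `(-1)^b` of a bit `b`. -/
def bitSign (b : ZMod 2) : ℝ := if b = 0 then 1 else -1

@[simp] lemma bitSign_zero : bitSign 0 = 1 := by simp [bitSign]

@[simp] lemma bitSign_one : bitSign 1 = -1 := by simp [bitSign]

lemma forall_bit {p : ZMod 2 → Prop} : (∀ b, p b) ↔ p 0 ∧ p 1 :=
  ⟨fun h ↦ ⟨h 0, h 1⟩, fun h b ↦ by fin_cases b; exacts [h.1, h.2]⟩

lemma bit_one_add_one : (1 + 1 : ZMod 2) = 0 := by decide

lemma bitSign_add (a b : ZMod 2) : bitSign (a + b) = bitSign a * bitSign b := by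
  revert a b
  simp [forall_bit, bit_one_add_one]

lemma abs_bitSign (b : ZMod 2) : |bitSign b| = 1 := by
  revert b
  simp [forall_bit]

lemma bitSign_sum {ι : Type*} (s : Finset ι) (f : ι → ZMod 2) :
    bitSign (∑ i ∈ s, f i) = ∏ i ∈ s, bitSign (f i) := by
  classical
  induction s using Finset.induction_on with
  | empty => simp
  | insert a s ha ih => rw [sum_insert ha, prod_insert ha, bitSign_add, ih]

lemma sum_bitSign_mul (x x' : ZMod 2) :
    ∑ b, bitSign (x * b) * bitSign (x' * b) = if x = x' then 2 else 0 := by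
  have h : ∀ f : ZMod 2 → ℝ, ∑ b, f b = f 0 + f 1 := fun f ↦ Fin.sum_univ_two f
  rw [h]
  revert x x'
  simp [forall_bit]
  norm_num

lemma sum_bitSign_innerProductMod2 (n : ℕ) (x x' : Fin n → ZMod 2) :
    ∑ y, bitSign (innerProductMod2 n x y) * bitSign (innerProductMod2 n x' y) =
      if x = x' then (Fintype.card (Fin n → ZMod 2) : ℝ) else 0 := by
  simp only [innerProductMod2, bitSign_sum, ← prod_mul_distrib]
  rw [← Fintype.piFinset_univ,
    ← prod_univ_sum (fun _ ↦ univ) fun i b ↦ bitSign (x i * b) * bitSign (x' i * b)]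
  simp only [sum_bitSign_mul]
  split_ifs with h
  · subst h; simp
  · obtain ⟨i, hi⟩ := Function.ne_iff.1 h
    exact prod_eq_zero (mem_univ i) (by simp [hi])

end Sign

/-! ### Hermitian matrices as real vectors; the lower bound. -/

section Quantum

open Matrix Finset

variable {N : ℕ}

/-- The real coordinates `Re Aᵢⱼ + Im Aᵢⱼ` of a complex matrix. On Hermitian matrices this is an
isometry for the trace inner product. -/
def realCoords (A : Matrix (Fin N) (Fin N) ℂ) (p : Fin N × Fin N) : ℝ :=
  (A p.1 p.2).re + (A p.1 p.2).im

/-- The Hermitian matrix with given real coordinates. -/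
noncomputable def hermitianOfCoords (r : Fin N × Fin N → ℝ) : Matrix (Fin N) (Fin N) ℂ :=
  Matrix.of fun i j ↦ ⟨(r (i, j) + r (j, i)) / 2, (r (i, j) - r (j, i)) / 2⟩

lemma isHermitian_hermitianOfCoords (r : Fin N × Fin N → ℝ) :
    (hermitianOfCoords r).IsHermitian := by
  ext i j
  apply Complex.ext <;> simp [hermitianOfCoords] <;> ring

lemma realCoords_hermitianOfCoords (r : Fin N × Fin N → ℝ) :
    realCoords (hermitianOfCoords r) = r := by
  ext ⟨i, j⟩
  simp [realCoords, hermitianOfCoords]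
  ring

lemma trace_hermitianOfCoords {r : Fin N × Fin N → ℝ} (hr : ∀ i, r (i, i) = 0) :
    (hermitianOfCoords r).trace = 0 := by
  refine sum_eq_zero fun i _ ↦ ?_
  apply Complex.ext <;> simp [hermitianOfCoords, hr]

lemma re_trace_mul_eq_dotProduct {A B : Matrix (Fin N) (Fin N) ℂ} (hA : A.IsHermitian)
    (hB : B.IsHermitian) : (A * B).trace.re = realCoords A ⬝ᵥ realCoords B := by
  have hre : ∀ {C : Matrix (Fin N) (Fin N) ℂ}, C.IsHermitian → ∀ i j, (C j i).re = (C i j).re :=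
    fun hC i j ↦ by rw [← hC.apply j i]; simp
  have him : ∀ {C : Matrix (Fin N) (Fin N) ℂ}, C.IsHermitian → ∀ i j, (C j i).im = -(C i j).im :=
    fun hC i j ↦ by rw [← hC.apply j i]; simp
  -- Swapping `i` and `j` negates each cross term, as real parts are symmetric and imaginary parts
  -- antisymmetric.
  have hcross : ∑ i, ∑ j, ((A i j).re * (B i j).im + (A i j).im * (B i j).re) = 0 := by
    have h : ∑ i, ∑ j, ((A i j).re * (B i j).im + (A i j).im * (B i j).re) =
        -∑ i, ∑ j, ((A i j).re * (B i j).im + (A i j).im * (B i j).re) := by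
      conv_lhs => rw [sum_comm]
      simp only [← sum_neg_distrib]
      refine sum_congr rfl fun i _ ↦ sum_congr rfl fun j _ ↦ ?_
      rw [hre hA i j, hre hB i j, him hA i j, him hB i j]
      ring
    linarith
  rw [← add_zero (A * B).trace.re, ← hcross]
  simp only [trace, diag_apply, Matrix.mul_apply, Complex.re_sum, dotProduct,
    Fintype.sum_prod_type, ← sum_add_distrib, realCoords, Complex.mul_re]
  refine sum_congr rfl fun i _ ↦ sum_congr rfl fun j _ ↦ ?_
  rw [hre hB i j, him hB i j]
  ring

/-- The two outcome probabilities sum to 1, so success above 1/2 means that their difference `Tr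
((E₀ - E₁) ρ)` has the sign of `f x y`. -/
lemma dotProduct_realCoords_pos_of_computes {X Y : Type*} {q : ℕ}
    {P : OneWayQuantumProtocol X Y q} {f : X → Y → ZMod 2} (hP : P.Computes f) (x : X) (y : Y) :
    0 < bitSign (f x y) * (realCoords (P.state x).mat ⬝ᵥ
      realCoords ((P.measurement y).effect 0 - (P.measurement y).effect 1)) := by
  set E := P.measurement y
  set ρ := P.state x
  have hE := fun b ↦ (E.posSemidef b).isHermitian
  rw [dotProduct_comm,
    ← re_trace_mul_eq_dotProduct ((hE 0).sub (hE 1)) ρ.posSemidef.isHermitian, Matrix.sub_mul, trace_sub, Complex.sub_re]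
  have hsum : E.prob ρ 0 + E.prob ρ 1 = 1 := by
    have h01 : E.effect 0 + E.effect 1 = 1 := by
      rw [← E.sum_eq_one]
      exact (Fin.sum_univ_two E.effect).symm
    rw [BinaryPOVM.prob, BinaryPOVM.prob, ← Complex.add_re, ← trace_add, ← Matrix.add_mul, h01,
      Matrix.one_mul, ρ.trace_eq_one, Complex.one_re]
  have h := hP x y
  change 1 / 2 < E.prob ρ (f x y) at h
  change 0 < bitSign (f x y) * (E.prob ρ 0 - E.prob ρ 1)
  generalize f x y = b at h ⊢
  revert b
  rw [forall_bit]
  constructor <;> intro h <;> simp <;> linarith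

lemma le_four_mul_of_computes {n q : ℕ}
    {P : OneWayQuantumProtocol (Fin n → ZMod 2) (Fin n → ZMod 2) q}
    (hP : P.Computes (innerProductMod2 n)) : n ≤ 4 * q := by
  let e : Fin (2 ^ q * 2 ^ q) ≃ Fin (2 ^ q) × Fin (2 ^ q) := finProdFinEquiv.symm
  have h := card_le_sq_of_sign_realization (fun x y ↦ bitSign (innerProductMod2 n x y))
    (fun x y ↦ abs_bitSign _) (sum_bitSign_innerProductMod2 n)
    (fun x ↦ realCoords (P.state x).mat ∘ e)
    (fun y ↦ realCoords ((P.measurement y).effect 0 - (P.measurement y).effect 1) ∘ e)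
    (fun x y ↦ by
      rw [comp_equiv_dotProduct_comp_equiv]
      exact dotProduct_realCoords_pos_of_computes hP x y)
  simp only [Fintype.card_pi, ZMod.card, prod_const, card_univ, Fintype.card_fin] at h
  rw [← pow_add, ← pow_mul] at h
  have := (Nat.pow_le_pow_iff_right one_lt_two).1 h
  omega

/-- A Hermitian matrix can be scaled so that `1 + εA` and `1 - εA` are positive semidefinite. -/
lemma exists_posSemidef_one_add_smul {A : Matrix (Fin N) (Fin N) ℂ} (hA : A.IsHermitian) :
    ∃ ε : ℝ, 0 < ε ∧ ∀ s : ℝ, |s| ≤ 1 → (1 + (s * ε) • A).PosSemidef := by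
  open scoped Matrix.Norms.L2Operator MatrixOrder in
  have hA' : IsSelfAdjoint A := hA
  have h1 := le_iff.1 hA'.le_algebraMap_norm_self
  have h2 := le_iff.1 hA'.neg_algebraMap_norm_le_self
  rw [Algebra.algebraMap_eq_smul_one] at h1 h2
  have h0 : (0 : ℝ) < 1 + ‖A‖ := by positivity
  refine ⟨(1 + ‖A‖)⁻¹, inv_pos.2 h0, fun s hs ↦ ?_⟩
  rw [abs_le] at hs
  -- A nonnegative combination of `1` and `‖A‖ • 1 ± A`.
  have h3 : 1 + (s * (1 + ‖A‖)⁻¹) • A = (1 + ‖A‖)⁻¹ • ((1 : ℝ) • 1 + ((1 - s) / 2) • (‖A‖ • 1 - A)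
      + ((1 + s) / 2) • (A - -(‖A‖ • 1))) := by
    have : (1 : Matrix (Fin N) (Fin N) ℂ) = ((1 + ‖A‖)⁻¹ * (1 + ‖A‖)) • 1 := by
      rw [inv_mul_cancel₀ h0.ne', one_smul]
    conv_lhs => rw [this]
    module
  rw [h3]
  exact (((PosSemidef.one.smul zero_le_one).add (h1.smul (by linarith))).add
    (h2.smul (by linarith))).smul (inv_nonneg.2 h0.le)

end Quantum

/-! ### A low-dimensional sign realization of the inner product. -/

open Matrix Finset in
-- Two more bits triple the dimension by tensoring with a realization of `IP_2`; the constant is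
-- forced by `n = 1`, where dimension 2 gives equality.
lemma exists_sign_realization_innerProductMod2 (n : ℕ) :
    ∃ (ι : Type) (_ : Fintype ι), 3 * Fintype.card ι ^ 2 ≤ 4 * 3 ^ n ∧ 0 < Fintype.card ι ∧
      ∃ u v : (Fin n → ZMod 2) → ι → ℝ,
        ∀ x y, 0 < bitSign (innerProductMod2 n x y) * (u x ⬝ᵥ v y) := by
  induction n using Nat.twoStepInduction with
  | zero =>
    exact ⟨Unit, inferInstance, by simp, by simp, fun _ _ ↦ 1, fun _ _ ↦ 1,
      fun x y ↦ by simp [innerProductMod2]⟩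
  | one =>
    refine ⟨Fin 2, inferInstance, by simp, by simp,
      fun x ↦ if x 0 = 0 then ![1, 0] else ![0, 1],
      fun y ↦ if y 0 = 0 then ![1, 1] else ![1, -1], fun x y ↦ ?_⟩
    simp only [innerProductMod2, Fin.sum_univ_one]
    generalize x 0 = a
    generalize y 0 = b
    revert a b
    simp [forall_bit]
  | more n ih _ =>
    obtain ⟨ι, _, hcard, h0, u, v, huv⟩ := ih
    let a : ZMod 2 → ZMod 2 → Fin 3 → ℝ := fun b c ↦
      if b = 0 then if c = 0 then ![1, 0, 0] else ![0, 1, 0]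
      else if c = 0 then ![0, 0, 1] else ![1, 1, 1]
    -- The coordinates carry the signs for the first three values of `a`; their sum carries the sign
    -- for the fourth.
    let d : ZMod 2 → ZMod 2 → Fin 3 → ℝ := fun b c ↦
      if b = 0 then if c = 0 then ![1, 1, 1] else ![1, -3, 1]
      else if c = 0 then ![1, 1, -3] else ![3, -1, -1]
    have had : ∀ b c b' c', 0 < bitSign (b * b' + c * c') * (a b c ⬝ᵥ d b' c') := by
      simp [forall_bit, a, d, bit_one_add_one, Matrix.vecHead, Matrix.vecTail]
      norm_num
    refine ⟨Fin 3 × ι, inferInstance, ?_, by simpa using h0,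
      fun x p ↦ a (x 0) (x 1) p.1 * u (fun i ↦ x i.succ.succ) p.2,
      fun y p ↦ d (y 0) (y 1) p.1 * v (fun i ↦ y i.succ.succ) p.2, fun x y ↦ ?_⟩
    · rw [Fintype.card_prod, Fintype.card_fin, pow_add]
      nlinarith
    · have hip : innerProductMod2 (n + 2) x y = (x 0 * y 0 + x 1 * y 1) +
          innerProductMod2 n (fun i ↦ x i.succ.succ) fun i ↦ y i.succ.succ := by
        simp only [innerProductMod2, Fin.sum_univ_succ (n := n + 1), Fin.sum_univ_succ (n := n)]
        exact (add_assoc _ _ _).symm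
      have hdot : (fun p : Fin 3 × ι ↦ a (x 0) (x 1) p.1 * u (fun i ↦ x i.succ.succ) p.2) ⬝ᵥ
          (fun p ↦ d (y 0) (y 1) p.1 * v (fun i ↦ y i.succ.succ) p.2) =
          (a (x 0) (x 1) ⬝ᵥ d (y 0) (y 1)) *
            (u (fun i ↦ x i.succ.succ) ⬝ᵥ v fun i ↦ y i.succ.succ) := by
        simp only [dotProduct, Fintype.sum_prod_type, sum_mul_sum]
        exact sum_congr rfl fun i _ ↦ sum_congr rfl fun k _ ↦ by ring
      rw [hip, bitSign_add, hdot, mul_mul_mul_comm]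
      exact mul_pos (had _ _ _ _) (huv _ _)

/-! ### Protocols from sign realizations. -/

section Quantum

open Matrix Finset

variable {N : ℕ}

/-- The state `(1 + εA) / N` for a traceless matrix `A`. -/
noncomputable def stateOfTraceless (hN : 0 < N) (A : Matrix (Fin N) (Fin N) ℂ) (hA : A.trace = 0)
    (ε : ℝ) (h : (1 + ε • A).PosSemidef) : QuantumState N where
  mat := (N : ℝ)⁻¹ • (1 + ε • A)
  posSemidef := h.smul (by positivity)
  trace_eq_one := by
    have : (N : ℂ) ≠ 0 := by exact_mod_cast hN.ne'
    simp [trace_smul, trace_add, hA, this]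

/-- The measurement with effects `(1 ± δB) / 2`. -/
noncomputable def povmOfHermitian (B : Matrix (Fin N) (Fin N) ℂ) (δ : ℝ)
    (h : ∀ b, (1 + (bitSign b * δ) • B).PosSemidef) : BinaryPOVM N where
  effect b := (2 : ℝ)⁻¹ • (1 + (bitSign b * δ) • B)
  posSemidef b := (h b).smul (by positivity)
  sum_eq_one := by
    refine (Fin.sum_univ_two _).trans ?_
    change (2 : ℝ)⁻¹ • (1 + (bitSign 0 * δ) • B) + (2 : ℝ)⁻¹ • (1 + (bitSign 1 * δ) • B) = 1
    rw [bitSign_zero, bitSign_one]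
    module

lemma prob_povmOfHermitian_stateOfTraceless (hN : 0 < N) {A B : Matrix (Fin N) (Fin N) ℂ}
    (hA : A.trace = 0) (hB : B.trace = 0) {ε δ : ℝ} (h : (1 + ε • A).PosSemidef)
    (h' : ∀ b, (1 + (bitSign b * δ) • B).PosSemidef) (b : ZMod 2) :
    (povmOfHermitian B δ h').prob (stateOfTraceless hN A hA ε h) b =
      1 / 2 + ε * δ / (2 * N) * (bitSign b * (A * B).trace.re) := by
  have hN' : (N : ℝ) ≠ 0 := by exact_mod_cast hN.ne'
  simp only [BinaryPOVM.prob, povmOfHermitian, stateOfTraceless, Matrix.add_mul, Matrix.mul_add, Matrix.one_mul, Matrix.mul_one, trace_smul, trace_add, hA, hB,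
    trace_one, Fintype.card_fin, smul_zero, add_zero, smul_mul_assoc, mul_smul_comm, zero_add,
    Complex.smul_re, Complex.add_re, Complex.natCast_re, smul_eq_mul, trace_mul_comm B A]
  field_simp

lemma dotProduct_extend {ι κ : Type*} [Fintype ι] [Fintype κ] (f : ι ↪ κ) (u v : ι → ℝ) :
    Function.extend f u 0 ⬝ᵥ Function.extend f v 0 = u ⬝ᵥ v := by
  refine (Fintype.sum_of_injective f f.injective _ _ (fun p hp ↦ ?_) fun i ↦ ?_).symm
  · rw [Function.extend_apply' _ _ _ hp]; simp
  · simp [f.injective.extend_apply]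

/-- Vectors realizing the signs of `f`, few enough dimensions to fit off the diagonal of a
`2 ^ q × 2 ^ q` matrix, give a `q`-qubit protocol for `f`. -/
lemma exists_computes_of_sign_realization {X Y ι : Type*} [Fintype ι] {f : X → Y → ZMod 2} {q : ℕ}
    (hcard : Fintype.card ι + 2 ^ q ≤ 2 ^ q * 2 ^ q) (u : X → ι → ℝ) (v : Y → ι → ℝ)
    (huv : ∀ x y, 0 < bitSign (f x y) * (u x ⬝ᵥ v y)) :
    ∃ P : OneWayQuantumProtocol X Y q, P.Computes f := by
  -- A zero diagonal makes the matrices traceless, so the states have trace 1 and the probabilities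
  -- are 1/2 plus a multiple of the inner product.
  obtain ⟨g⟩ : Nonempty (ι ↪ ((univ : Finset (Fin (2 ^ q))).offDiag)) := by
    refine Function.Embedding.nonempty_of_card_le ?_
    rw [Fintype.card_coe, offDiag_card]
    simp only [card_univ, Fintype.card_fin]
    omega
  let g' : ι ↪ Fin (2 ^ q) × Fin (2 ^ q) := g.trans (Function.Embedding.subtype _)
  let H : (ι → ℝ) → Matrix (Fin (2 ^ q)) (Fin (2 ^ q)) ℂ := fun w ↦
    hermitianOfCoords (Function.extend g' w 0)
  have hH : ∀ w, (H w).IsHermitian := fun w ↦ isHermitian_hermitianOfCoords _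
  have htr : ∀ w, (H w).trace = 0 := fun w ↦ trace_hermitianOfCoords fun i ↦ by
    refine Function.extend_apply' _ _ _ ?_
    rintro ⟨k, hk⟩
    have := (mem_offDiag.1 (g k).2).2.2
    change (g' k).1 ≠ (g' k).2 at this
    simp [hk] at this
  choose ε hε hpsd using fun w ↦ exists_posSemidef_one_add_smul (hH w)
  refine ⟨⟨fun x ↦ stateOfTraceless (by positivity) (H (u x)) (htr _) (ε (u x))
      (by simpa using hpsd (u x) 1 (by simp)),
    fun y ↦ povmOfHermitian (H (v y)) (ε (v y)) fun b ↦ hpsd _ _ (abs_bitSign b).le⟩,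
    fun x y ↦ ?_⟩
  rw [prob_povmOfHermitian_stateOfTraceless _ _ (htr _), re_trace_mul_eq_dotProduct (hH _) (hH _),
    realCoords_hermitianOfCoords, realCoords_hermitianOfCoords, dotProduct_extend]
  have h1 := hε (u x)
  have h2 := hε (v y)
  have h3 := huv x y
  have : 0 < ε (u x) * ε (v y) / (2 * (2 ^ q : ℕ)) *
    (bitSign (f x y) * (u x ⬝ᵥ v y)) := by positivity
  linarith

end Quantum

/-! ### Arithmetic of the upper bound; conclusion. -/

lemma add_two_pow_le_of_three_mul_sq_le {r q : ℕ} (hr : 0 < r) (h : 3 * r ^ 2 ≤ 16 ^ q) :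
    r + 2 ^ q ≤ 2 ^ q * 2 ^ q := by
  have h16 : (16 : ℕ) ^ q = (2 ^ q) ^ 4 := by
    rw [← pow_mul, mul_comm, pow_mul]; norm_num
  rw [h16] at h
  -- For `q = 0` the hypothesis fails; for `q = 1` it gives `r ≤ 2`, which just fits. For `m = 2 ^ q
  -- ≥ 4`, `r ≤ m ^ 2 / √3 < 3 / 4 * m ^ 2 ≤ m ^ 2 - m`.
  obtain _ | _ | q := q
  · simp at h; nlinarith
  · norm_num at h ⊢
    nlinarith
  · have h4 : 4 ≤ 2 ^ (q + 1 + 1) := by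
      rw [pow_add, pow_add]; have := Nat.one_le_two_pow (n := q); omega
    generalize 2 ^ (q + 1 + 1) = m at h h4 ⊢
    by_contra! hlt
    obtain ⟨k, rfl⟩ := Nat.exists_eq_add_of_le h4
    nlinarith [mul_self_nonneg k]

lemma four_mul_three_pow_le {n q : ℕ} (h : (Real.logb 2 3 * n + 2) / 4 ≤ q) :
    4 * 3 ^ n ≤ 16 ^ q := by
  have h1 : Real.logb 2 3 * n + 2 ≤ 4 * q := by linarith
  have h2 := Real.rpow_le_rpow_of_exponent_le one_le_two h1
  rw [Real.rpow_add two_pos, Real.rpow_mul zero_le_two, Real.rpow_logb two_pos (by norm_num)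
    (by norm_num), Real.rpow_mul zero_le_two, Real.rpow_natCast, Real.rpow_natCast] at h2
  norm_num at h2
  have h3 : (3 : ℝ) ^ n * 4 ≤ 16 ^ q := h2
  rw [mul_comm]
  exact_mod_cast h3

theorem mainTheorem8 (n : ℕ) :
    ((⌈(n : ℝ) / 4⌉₊ : ℕ) : ℕ∞) ≤ unboundedErrorQ (innerProductMod2 n) ∧
      unboundedErrorQ (innerProductMod2 n) ≤
        ((⌈(Real.logb 2 3 * (n : ℝ) + 2) / 4⌉₊ : ℕ) : ℕ∞) := by
  constructor
  · rw [unboundedErrorQ]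
    refine le_iInf₂ fun q hq ↦ ?_
    obtain ⟨P, hP⟩ := hq
    have h : (n : ℝ) ≤ 4 * q := by exact_mod_cast le_four_mul_of_computes hP
    exact_mod_cast Nat.ceil_le.2 (by linarith)
  · obtain ⟨ι, _, hcard, h0, u, v, huv⟩ := exists_sign_realization_innerProductMod2 n
    have hP := exists_computes_of_sign_realization (add_two_pow_le_of_three_mul_sq_le h0
      (hcard.trans (four_mul_three_pow_le (Nat.le_ceil _)))) u v huv
    rw [unboundedErrorQ]
    exact iInf₂_le (f := fun (q : ℕ) _ ↦ (q : ℕ∞)) _ hP
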